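/- Let $\mathcal X,\mathcal Y$ be finite alphabets, $K\ge 1$, and let $W_1=\dots=W_K$ be identical channels (stochastic matrices $W_k(y|x)$, $x\in\mathcal X$, $y\in\mathcal Y$), where $W_1$ is symmetric: the rows of the matrix are permutations of each other, and so are its columns. For a distribution $P$ on $\mathcal X$ let $PW_k(y)=\sum_x P(x)W_k(y|x)$, $i_{P,W_k}(x^n;y^n)=\sum_{i=1}^n\log\frac{W_k(y_i|x_i)}{PW_k(y_i)}$ (which is $0$ for $n=0$), and let $I(P,W_k)$ be the expectation of $i_{P,W_k}(X;Y)$ when $(X,Y)$ has distribution $P(x)W_k(y|x)$. Let $P^*$ be a capacity-achieving input distribution, i.e. a maximizer of $\min_k I(P,W_k)$ over all distributions $P$ on $\mathcal X$. For real $\ell\ge 0$, $\epsilon$ and an integer $M\ge 1$, an $(\ell,M,\epsilon)$-VLSF (variable-length stop-feedback) code consists of: (1) a random variable $U$ with values in a set $\mathcal U$ with $|\mathcal U|\le K+1$; (2) encoders $f_n:\mathcal U\times\{1,\dots,M\}\to\mathcal X$, $n\ge 1$, where a message $J$, uniform on $\{1,\dots,M\}$ and independent of $U$, yields the channel inputs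 $X_n=f_n(U,J)$, and, given $(U,J)$, the outputs $Y_{k,n}$ are independent over $k$ and $n$ with $Y_{k,n}\sim W_k(\cdot|X_n)$; (3) $\mathbb Z_{\ge 0}$-valued stopping times $\tau_k$ with respect to the filtrations $\sigma(U,Y_{k,1},\dots,Y_{k,n})$, $n\ge 0$, with $\mathbb E[\max_k\tau_k]\le\ell$; (4) decoders $g_{k,n}:\mathcal U\times\mathcal Y^n\to\{1,\dots,M\}$ with $\mathbb P[J\ne g_{k,\tau_k}(U,Y_k^{\tau_k})]\le\epsilon$ for every $k$, where $Y_k^n=(Y_{k,1},\dots,Y_{k,n})$. Let $M\ge 1$ be an integer, $\eta>0$, and let $(x_1,x_2,\dots)$ be an arbitrary sequence in $\mathcal X$. For $t\ge 0$ put $$v_t=\mathbb P\Big[\max_{0\le n\le t} i_{P^*,W_1}(x^n;Y^n)\ge \log M+\log\eta\Big],$$ where $Y_1,Y_2,\dots$ are independent with $Y_i\sim W_1(\cdot|x_i)$. Then every $(\ell,M,\epsilon)$-VLSF code satisfies $$\ell\;\ge\;\min\ \mathbb E\Big[\sum_{t=0}^\infty\Big(1-\min\{1,v_t+\varepsilon^{(\bar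 U)}\}^K\Big)\Big],$$ where the minimum is over all distributions of a random variable $\bar U$ with values in a fixed set $\bar{\mathcal U}$ of $K+1$ elements and all numbers $\varepsilon^{(u)}\in[0,1]$, $u\in\bar{\mathcal U}$, such that $\mathbb E[\varepsilon^{(\bar U)}]\le\epsilon+\eta$; the minimum is attained (in $[0,\infty]$). -/

import Mathlib

open MeasureTheory ProbabilityTheory
open scoped NNReal ENNReal

noncomputable section

namespace VLSF

/-- A discrete memoryless channel with input alphabet `X` and finite output alphabet `Y`, i.e.
a stochastic matrix: `W.prob x y` is the probability `W(y | x)`. -/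
structure Channel (X Y : Type*) [Fintype Y] where
  prob : X → Y → ℝ
  nonneg : ∀ x y, 0 ≤ prob x y
  sum_one : ∀ x, ∑ y, prob x y = 1

section Information

variable {X Y : Type*} [Fintype X] [Fintype Y]

/-- The output distribution `PW : y ↦ ∑ₓ P(x) W(y | x)`. -/
def outputDist (P : X → ℝ) (W : Channel X Y) (y : Y) : ℝ :=
  ∑ x, P x * W.prob x y

/-- The information density `i_{P,W}(xⁿ; yⁿ) = ∑ᵢ log (W(yᵢ | xᵢ) / PW(yᵢ))`; it is `0` for `n = 0`.
Where `W(yᵢ | xᵢ) = 0` the corresponding summand is `0` here instead of `-∞`; such `yⁿ` have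
probability zero given `xⁿ`, so that the probabilities and expectations below are not affected. -/
def infoDensity (P : X → ℝ) (W : Channel X Y) {n : ℕ} (x : Fin n → X) (y : Fin n → Y) : ℝ :=
  ∑ i, Real.log (W.prob (x i) (y i) / outputDist P W (y i))

/-- The mutual information `I(P, W)`: the expectation of `i_{P,W}(X; Y)` under `P × W`. -/
def mutualInfo (P : X → ℝ) (W : Channel X Y) : ℝ :=
  ∑ x, ∑ y, P x * W.prob x y * infoDensity P W (fun _ : Fin 1 => x) (fun _ : Fin 1 => y)

/-- `P` attains the capacity `sup_P min_k I(P, W_k)` of the common-message discrete memoryless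
broadcast channel with component channels `W_1, …, W_K`. -/
def IsCapacityAchieving {K : ℕ} (W : Fin K → Channel X Y) (P : X → ℝ) : Prop :=
  P ∈ stdSimplex ℝ X ∧
    ∀ P' ∈ stdSimplex ℝ X, ⨅ k, mutualInfo P' (W k) ≤ ⨅ k, mutualInfo P (W k)

/-- A channel is symmetric if the rows of its matrix are permutations of each other, and so are
its columns. -/
def Channel.IsSymmetric (W : Channel X Y) : Prop :=
  (∀ x x' : X, ∃ σ : Equiv.Perm Y, ∀ y, W.prob x' y = W.prob x (σ y)) ∧
    (∀ y y' : Y, ∃ σ : Equiv.Perm X, ∀ x, W.prob x y' = W.prob (σ x) y)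

/-- `max_{0 ≤ n ≤ t} i_{P,W}(xⁿ; yⁿ)`, where `xⁿ`, `yⁿ` are the first `n` entries. -/
def maxInfoDensity (P : X → ℝ) (W : Channel X Y) {t : ℕ} (x : Fin t → X) (y : Fin t → Y) : ℝ :=
  Finset.univ.sup' Finset.univ_nonempty fun n : Fin (t + 1) =>
    infoDensity P W (fun i : Fin n => x (Fin.castLE (Nat.le_of_lt_succ n.2) i))
      (fun i : Fin n => y (Fin.castLE (Nat.le_of_lt_succ n.2) i))

open Classical in
/-- The probability `P[max_{0 ≤ n ≤ t} i_{P,W}(xⁿ; Yⁿ) ≥ lam]`, where `Y_1, …, Y_t` are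
independent with `Y_i` distributed according to `W(· | x_i)`. The entry `x_{i+1}` is `x i`. -/
def crossingProb (P : X → ℝ) (W : Channel X Y) (x : ℕ → X) (lam : ℝ) (t : ℕ) : ℝ :=
  ∑ y : Fin t → Y,
    if lam ≤ maxInfoDensity P W (fun i : Fin t => x i) y then ∏ i : Fin t, W.prob (x i) (y i) else 0

end Information

section Code

variable {Ω 𝒰 Y : Type*} [mΩ : MeasurableSpace Ω] [Finite 𝒰] [Finite Y]

/-- The filtration `ℱ_n = σ(U, Y_1, …, Y_n)` (the output `Y_{i+1}` is `Y i`). The finite alphabets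
carry the discrete σ-algebra `⊤`. -/
def obsFiltration (U : Ω → 𝒰) (Y' : ℕ → Ω → Y) (hU : Measurable[mΩ, ⊤] U)
    (hY : ∀ i, Measurable[mΩ, ⊤] (Y' i)) : Filtration ℕ mΩ where
  seq n := MeasurableSpace.comap (fun ω => (U ω, fun i : Fin n => Y' i ω)) ⊤
  mono' := by
    rintro n m hnm _ ⟨s, -, rfl⟩
    exact ⟨(fun p : 𝒰 × (Fin m → Y) => (p.1, fun i : Fin n => p.2 (Fin.castLE hnm i))) ⁻¹' s,
      trivial, rfl⟩
  le' := by
    rintro n _ ⟨s, -, rfl⟩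
    let _ : MeasurableSpace 𝒰 := ⊤
    let _ : MeasurableSpace Y := ⊤
    have h : Measurable (fun ω => (U ω, fun i : Fin n => Y' i ω)) :=
      Measurable.prodMk hU (measurable_pi_lambda _ fun i => hY i)
    exact h (Set.toFinite s).measurableSet

end Code

/-- An `(ℓ, M, ε)` variable-length stop-feedback (VLSF) code for the common-message discrete
memoryless broadcast channel with component channels `W_1, …, W_K`. The random variables live on
the probability space `(Ω, μ)`, and the common randomness `U` takes values in `𝒰`. Time is indexed
from zero: `f i`, `Y k i` are the encoder and the output of channel `k` at time `i + 1`. -/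
structure Code {X Y : Type*} [Fintype Y] {K : ℕ} [NeZero K] (W : Fin K → Channel X Y)
    (ℓ : ℝ≥0) (M : ℕ) (ε : ℝ)
    {Ω 𝒰 : Type*} [mΩ : MeasurableSpace Ω] (μ : Measure Ω) [Fintype 𝒰] where
  /-- the alphabet of the common randomness has at most `K + 1` elements -/
  card_le : Fintype.card 𝒰 ≤ K + 1
  /-- the common randomness -/
  U : Ω → 𝒰
  measurable_U : Measurable[mΩ, ⊤] U
  /-- the message -/
  J : Ω → Fin M
  measurable_J : Measurable[mΩ, ⊤] J
  /-- the channel outputs -/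
  out : Fin K → ℕ → Ω → Y
  measurable_out : ∀ k i, Measurable[mΩ, ⊤] (out k i)
  /-- the encoders -/
  f : ℕ → 𝒰 → Fin M → X
  /-- The message is uniform and independent of `U`, and given `U` and `J` the outputs are
  independent over time and over the decoders, with law `W_k(· | f_i(U, J))`. -/
  law : ∀ (n : ℕ) (u : 𝒰) (j : Fin M) (y : Fin K → Fin n → Y),
    μ.real {ω | U ω = u ∧ J ω = j ∧ ∀ k, ∀ i : Fin n, out k i ω = y k i} =
      μ.real {ω | U ω = u} * (M : ℝ)⁻¹ * ∏ k, ∏ i : Fin n, (W k).prob (f i u j) (y k i)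
  /-- the stopping times -/
  τ : Fin K → Ω → ℕ
  isStoppingTime : ∀ k, IsStoppingTime
    (obsFiltration U (out k) measurable_U (measurable_out k)) (fun ω => (τ k ω : WithTop ℕ))
  /-- `E[max_k τ_k] ≤ ℓ` -/
  expected_le : ∫⁻ ω, ((Finset.univ.sup' Finset.univ_nonempty fun k => τ k ω : ℕ) : ℝ≥0∞) ∂μ ≤ ℓ
  /-- the decoders -/
  g : (k : Fin K) → (n : ℕ) → 𝒰 → (Fin n → Y) → Fin M
  /-- `P[J ≠ g_{k,τ_k}(U, Y_k^{τ_k})] ≤ ε` -/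
  error_le : ∀ k,
    μ.real {ω | J ω ≠ g k (τ k ω) (U ω) (fun i : Fin (τ k ω) => out k i ω)} ≤ ε

/-- The values of the objective `E[∑_{t ≥ 0} (1 - min{1, v_t + e^{(U)}}^K)]`, in `[0, ∞]`, over all
feasible points of the minimization: distributions `p` of a random variable `U` with values in
a set of `K + 1` elements and `e^{(u)} ∈ [0, 1]` with `E[e^{(U)}] ≤ c`. -/
def objectiveValues (K : ℕ) (v : ℕ → ℝ) (c : ℝ) : Set ℝ≥0∞ :=
  {r | ∃ p ∈ stdSimplex ℝ (Fin (K + 1)), ∃ e : Fin (K + 1) → ℝ,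
    (∀ u, e u ∈ Set.Icc (0 : ℝ) 1) ∧ ∑ u, p u * e u ≤ c ∧
    r = ∑ u, ENNReal.ofReal (p u) * ∑' t : ℕ, ENNReal.ofReal (1 - min 1 (v t + e u) ^ K)}

end VLSF

end

/-!
Fix the common randomness `u` and the message `j`. A decoder that has stopped by time `t` has
either seen its information density reach `log M + log η` by then, or it stops early, below this
threshold. The capacity-achieving output distribution of a symmetric channel is uniform
(`outputDist_eq_inv_card`, by strict concavity of the entropy), and since the rows of the channel
are permutations of each other, the probability of the first event is `v t` for every input word
(`crossingProb_congr`).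

Stopping early is unlikely, on average over `u` and `j`: it comes with a decoding error, which
contributes `ε`, or with the correct estimate. In the latter case the output word is at most `M * η`
times as likely as under uniform outputs. Uniform outputs carry no information about the message,
and the words on which a decoder stops are prefix-free, so that Kraft's inequality
(`sum_blockProb_le_one`) bounds this contribution by `η`
(`Code.measureReal_stopsEarly_inter_isCorrect_le`).

Given `u` and `j`, the decoders are independent. Hence all of them have stopped by time `t` with
probability at most the product over `k` of `min{1, v t + eₖ}`, where `eₖ` is the conditional
probability that decoder `k` stops early; by the inequality of the means and concavity of
`a ↦ min{1, v t + a}`, this is at most the `K`-th power of that function at the average of the `eₖ`.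
Summing over `t` bounds the expected maximum of the stopping times below by the objective, for a
mixture indexed by the pairs `(u, j)` (`Code.sum_weight_mul_pointObjective_le`). Two error levels
suffice for the same or a smaller value under the same constraint (`exists_objectiveValues_le`),
which fits into the `K + 1` available ones. The minimum is attained by compactness and lower
semicontinuity.
-/

namespace VLSF

/-! ### Output distribution of a symmetric channel -/

section SymmetricChannel

variable {X Y : Type*} [Fintype X] [Fintype Y]

theorem outputDist_nonneg {P : X → ℝ} (hP : P ∈ stdSimplex ℝ X) (W : Channel X Y) (y : Y) :
    0 ≤ outputDist P W y :=
  Finset.sum_nonneg fun x _ => mul_nonneg (hP.1 x) (W.nonneg x y)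

theorem sum_outputDist {P : X → ℝ} (hP : P ∈ stdSimplex ℝ X) (W : Channel X Y) :
    ∑ y, outputDist P W y = 1 := by
  simp only [outputDist]
  rw [Finset.sum_comm]
  simp [← Finset.mul_sum, W.sum_one, hP.2]

theorem mutualInfo_eq_entropy_sub {P : X → ℝ} (hP : P ∈ stdSimplex ℝ X) (W : Channel X Y) :
    mutualInfo P W = ∑ y, Real.negMulLog (outputDist P W y) -
      ∑ x, P x * ∑ y, Real.negMulLog (W.prob x y) := by
  have h1 : ∑ y, Real.negMulLog (outputDist P W y) =
      ∑ x, ∑ y, -(P x * W.prob x y * Real.log (outputDist P W y)) := by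
    rw [Finset.sum_comm]
    refine Finset.sum_congr rfl fun y _ => ?_
    rw [Real.negMulLog, Finset.sum_neg_distrib, ← Finset.sum_mul, outputDist, neg_mul]
  rw [h1, mutualInfo, ← Finset.sum_sub_distrib]
  refine Finset.sum_congr rfl fun x _ => ?_
  rw [Finset.mul_sum, ← Finset.sum_sub_distrib]
  refine Finset.sum_congr rfl fun y _ => ?_
  simp only [infoDensity, Finset.univ_unique, Finset.sum_const, Finset.card_singleton, one_smul,
    Real.negMulLog]
  by_cases hxy : P x * W.prob x y = 0
  · rcases mul_eq_zero.mp hxy with h | h <;> simp [h]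
  · have hW : W.prob x y ≠ 0 := right_ne_zero_of_mul hxy
    have hQ : 0 < outputDist P W y := by
      have hpos : 0 < P x * W.prob x y :=
        lt_of_le_of_ne (mul_nonneg (hP.1 x) (W.nonneg x y)) (Ne.symm hxy)
      exact hpos.trans_le (Finset.single_le_sum
        (f := fun x => P x * W.prob x y)
        (fun i _ => mul_nonneg (hP.1 i) (W.nonneg i y)) (Finset.mem_univ x))
    rw [Real.log_div hW hQ.ne']
    ring

/-- The uniform input distribution of a channel with permuted columns has uniform output. -/
theorem outputDist_uniform [Nonempty X] [Nonempty Y] {W : Channel X Y} (hW : W.IsSymmetric)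
    (y : Y) :
    outputDist (fun _ => (Fintype.card X : ℝ)⁻¹) W y = (Fintype.card Y : ℝ)⁻¹ := by
  have hconst : ∀ y', outputDist (fun _ => (Fintype.card X : ℝ)⁻¹) W y' =
      outputDist (fun _ => (Fintype.card X : ℝ)⁻¹) W y := by
    intro y'
    obtain ⟨σ, hσ⟩ := hW.2 y y'
    simp only [outputDist, hσ]
    exact Equiv.sum_comp σ fun x => (Fintype.card X : ℝ)⁻¹ * W.prob x y
  have hsum := sum_outputDist (P := fun _ : X => (Fintype.card X : ℝ)⁻¹)
    ⟨fun _ => by positivity, by simp⟩ W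
  simp only [hconst, Finset.sum_const, Finset.card_univ, nsmul_eq_mul] at hsum
  exact eq_inv_of_mul_eq_one_right hsum

/-- A capacity-achieving input distribution of a symmetric channel need not be uniform, but its
output distribution is: the conditional entropy of the output does not depend on the input, so
that the mutual information is largest exactly when the output entropy is. -/
theorem outputDist_eq_inv_card {P : X → ℝ} {W : Channel X Y} (hW : W.IsSymmetric)
    (hP : P ∈ stdSimplex ℝ X)
    (hmax : ∀ P' ∈ stdSimplex ℝ X, mutualInfo P' W ≤ mutualInfo P W) (y : Y) :
    outputDist P W y = (Fintype.card Y : ℝ)⁻¹ := by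
  have hY : Nonempty Y := ⟨y⟩
  have hX : Nonempty X := by
    by_contra h
    rw [not_nonempty_iff] at h
    simpa using hP.2
  have hcard : (0 : ℝ) < Fintype.card Y := by positivity
  obtain ⟨x₀⟩ := id hX
  have hrow : ∀ P' ∈ stdSimplex ℝ X, ∑ x, P' x * ∑ y, Real.negMulLog (W.prob x y) =
      ∑ y, Real.negMulLog (W.prob x₀ y) := by
    intro P' hP'
    have : ∀ x, ∑ y, Real.negMulLog (W.prob x y) = ∑ y, Real.negMulLog (W.prob x₀ y) := by
      intro x
      obtain ⟨σ, hσ⟩ := hW.1 x₀ x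
      simp only [hσ]
      exact Equiv.sum_comp σ fun y => Real.negMulLog (W.prob x₀ y)
    simp only [this]
    rw [← Finset.sum_mul, hP'.2, one_mul]
  have hunif : (fun _ : X => (Fintype.card X : ℝ)⁻¹) ∈ stdSimplex ℝ X :=
    ⟨fun _ => by positivity, by simp⟩
  have hent := hmax _ hunif
  rw [mutualInfo_eq_entropy_sub hunif, mutualInfo_eq_entropy_sub hP, hrow _ hunif, hrow _ hP,
    sub_le_sub_iff_right] at hent
  simp only [outputDist_uniform hW, Finset.sum_const, Finset.card_univ, nsmul_eq_mul] at hent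
  -- Equality in Jensen's inequality for the strictly concave entropy function.
  have hmean : ∑ y, (Fintype.card Y : ℝ)⁻¹ • outputDist P W y = (Fintype.card Y : ℝ)⁻¹ := by
    rw [← Finset.smul_sum, sum_outputDist hP]
    simp
  have hw : ∑ _y : Y, (Fintype.card Y : ℝ)⁻¹ = 1 := by simp
  have hmem : ∀ i ∈ (Finset.univ : Finset Y), outputDist P W i ∈ Set.Ici (0 : ℝ) :=
    fun i _ => outputDist_nonneg hP W i
  have hle := Real.concaveOn_negMulLog.le_map_sum (t := Finset.univ)
    (w := fun _ : Y => (Fintype.card Y : ℝ)⁻¹) (p := outputDist P W)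
    (fun _ _ => by positivity) hw hmem
  have heq := (Real.strictConcaveOn_negMulLog.map_sum_eq_iff (t := Finset.univ)
    (w := fun _ : Y => (Fintype.card Y : ℝ)⁻¹) (p := outputDist P W)
    (fun _ _ => by positivity) hw hmem).1 (le_antisymm ?_ hle) y (Finset.mem_univ y)
  · rw [heq, hmean]
  · rw [hmean, ← Finset.smul_sum, smul_eq_mul, ← div_eq_inv_mul, le_div_iff₀ hcard, mul_comm]
    exact hent

end SymmetricChannel

/-! ### Word probabilities, Kraft's inequality and the crossing probability -/

section Block

variable {X Y : Type*} [Fintype Y]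

open Classical in
/-- The probability that the first `n` outputs of the channel form a word in `S`, when the inputs
are `x 0, x 1, …`. -/
noncomputable def blockProb (W : Channel X Y) (x : ℕ → X) (n : ℕ) (S : Set (Fin n → Y)) : ℝ :=
  ∑ y : Fin n → Y, if y ∈ S then ∏ i : Fin n, W.prob (x i) (y i) else 0

theorem blockProb_univ (W : Channel X Y) (x : ℕ → X) (n : ℕ) :
    blockProb W x n Set.univ = 1 := by
  have h := Finset.prod_univ_sum (fun _ : Fin n => (Finset.univ : Finset Y))
    (fun i y => W.prob (x i) y)
  simp only [W.sum_one, Finset.prod_const_one, Fintype.piFinset_univ] at h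
  simp [blockProb, ← h]

theorem blockProb_nonneg (W : Channel X Y) (x : ℕ → X) (n : ℕ) (S : Set (Fin n → Y)) :
    0 ≤ blockProb W x n S := by
  refine Finset.sum_nonneg fun y _ => ?_
  split_ifs
  · exact Finset.prod_nonneg fun i _ => W.nonneg _ _
  · exact le_rfl

theorem blockProb_le_one (W : Channel X Y) (x : ℕ → X) (n : ℕ) (S : Set (Fin n → Y)) :
    blockProb W x n S ≤ 1 := by
  classical
  rw [← blockProb_univ W x n]
  refine Finset.sum_le_sum fun y _ => ?_
  rw [if_pos (Set.mem_univ y)]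
  split_ifs
  · exact le_rfl
  · exact Finset.prod_nonneg fun i _ => W.nonneg _ _

/-- The probability of a condition on a prefix does not depend on the length of the whole word. -/
theorem blockProb_prefix (W : Channel X Y) (x : ℕ → X) {n N : ℕ} (h : n ≤ N)
    (S : Set (Fin n → Y)) :
    blockProb W x N {z | (fun i => z (Fin.castLE h i)) ∈ S} = blockProb W x n S := by
  induction N, h using Nat.le_induction with
  | base => rfl
  | succ N h ih =>
    rw [← ih, blockProb, blockProb, ← (Fin.snocEquiv fun _ => Y).sum_comp,
      Fintype.sum_prod_type, Finset.sum_comm]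
    refine Finset.sum_congr rfl fun z _ => ?_
    have hmem : ∀ y : Y, (Fin.snocEquiv (fun _ => Y)) (y, z) ∈
        {z : Fin (N + 1) → Y | (fun i => z (Fin.castLE (Nat.le_succ_of_le h) i)) ∈ S} ↔
        z ∈ {z : Fin N → Y | (fun i => z (Fin.castLE h i)) ∈ S} := by
      intro y
      have : (fun i => (Fin.snocEquiv (fun _ => Y)) (y, z) (Fin.castLE (Nat.le_succ_of_le h) i)) =
          fun i => z (Fin.castLE h i) := by
        funext i
        exact Fin.snoc_castSucc (α := fun _ => Y) y z (Fin.castLE h i)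
      simp only [Set.mem_ofPred_eq]
      rw [this]
    classical
    refine (Finset.sum_congr rfl fun y _ => if_congr (hmem y) rfl rfl).trans ?_
    by_cases hz : z ∈ {z : Fin N → Y | (fun i => z (Fin.castLE h i)) ∈ S}
    · simp only [if_pos hz, Fin.prod_univ_castSucc, Fin.snocEquiv_apply, Fin.snoc_castSucc,
        Fin.snoc_last, Fin.val_castSucc, Fin.val_last]
      rw [← Finset.mul_sum, W.sum_one, mul_one]
    · simp only [if_neg hz, Finset.sum_const_zero]

/-- Kraft's inequality: the words of a prefix-free family have total probability at most `1`. -/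
theorem sum_blockProb_le_one (W : Channel X Y) (x : ℕ → X) (T : ∀ n, Set (Fin n → Y))
    (hT : ∀ (n m : ℕ) (h : n < m), ∀ y ∈ T m, (fun i => y (Fin.castLE h.le i)) ∉ T n) (N : ℕ) :
    ∑ n ∈ Finset.range N, blockProb W x n (T n) ≤ 1 := by
  classical
  have hpre : ∀ n : Fin N, blockProb W x n (T n) =
      blockProb W x N {z | (fun i => z (Fin.castLE n.2.le i)) ∈ T n} :=
    fun n => (blockProb_prefix W x n.2.le (T n)).symm
  rw [Finset.sum_range, Finset.sum_congr rfl fun n _ => hpre n, ← blockProb_univ W x N]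
  simp only [blockProb]
  rw [Finset.sum_comm]
  refine Finset.sum_le_sum fun z _ => ?_
  have hnn : 0 ≤ ∏ i : Fin N, W.prob (x i) (z i) := Finset.prod_nonneg fun i _ => W.nonneg _ _
  rw [if_pos (Set.mem_univ z)]
  by_cases hex : ∃ n : Fin N, (fun i => z (Fin.castLE n.2.le i)) ∈ T n
  · obtain ⟨n, hn⟩ := hex
    rw [Finset.sum_eq_single n]
    · split_ifs <;> simp [hnn]
    · intro m _ hmn
      refine if_neg fun hm => ?_
      rcases lt_or_gt_of_ne hmn with h | h
      · exact hT m n h _ hn hm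
      · exact hT n m h _ hm hn
    · simp
  · push Not at hex
    exact (Finset.sum_eq_zero fun n _ => if_neg (hex n)).trans_le hnn

theorem crossingProb_eq_blockProb [Fintype X] (P : X → ℝ) (W : Channel X Y) (x : ℕ → X) (lam : ℝ)
    (t : ℕ) : crossingProb P W x lam t =
      blockProb W x t {y | lam ≤ maxInfoDensity P W (fun i : Fin t => x i) y} := rfl

/-- For a channel with permuted rows and a uniform output distribution, permuting the output
letters carries the joint law of the information densities for one input sequence to that for
another. -/
theorem crossingProb_congr [Fintype X] {P : X → ℝ} {W : Channel X Y} (hW : W.IsSymmetric)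
    {q : ℝ} (hq : ∀ y, outputDist P W y = q) (x x' : ℕ → X) (lam : ℝ) (t : ℕ) :
    crossingProb P W x' lam t = crossingProb P W x lam t := by
  choose σ hσ using hW.1
  rw [crossingProb, crossingProb,
    ← (Equiv.piCongrRight fun i : Fin t => σ (x' i) (x i)).sum_comp]
  refine Finset.sum_congr rfl fun y _ => ?_
  simp only [maxInfoDensity, infoDensity, hq, Equiv.piCongrRight_apply,
    Pi.map_apply, Fin.val_castLE, ← hσ]

end Block

/-! ### The minimization over error levels -/

section Optimization

/-- If a convex combination of points of the plane lies in the lower left quadrant with corner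
`(c, V)`, then so does a convex combination of at most two of these points. -/
theorem exists_pair_le {ι : Type*} (s : Finset ι) (w d g : ι → ℝ) (c V : ℝ)
    (hw : ∀ i ∈ s, 0 < w i) (hw1 : ∑ i ∈ s, w i = 1) (hd : ∑ i ∈ s, w i * d i ≤ c)
    (hg : ∑ i ∈ s, w i * g i ≤ V) :
    ∃ i ∈ s, ∃ j ∈ s, ∃ a ∈ Set.Icc (0 : ℝ) 1,
      a * d i + (1 - a) * d j ≤ c ∧ a * g i + (1 - a) * g j ≤ V := by
  classical
  -- Move the corner to the origin.
  wlog hzero : c = 0 ∧ V = 0 generalizing d g c V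
  · have hshift : ∀ (f : ι → ℝ) (b : ℝ), ∑ i ∈ s, w i * (f i - b) = ∑ i ∈ s, w i * f i - b := by
      intro f b
      simp only [mul_sub, Finset.sum_sub_distrib, ← Finset.sum_mul, hw1, one_mul]
    obtain ⟨i, hi, j, hj, a, ha, h1, h2⟩ := this (fun i => d i - c) (fun i => g i - V) 0 0
      (by rw [hshift]; linarith) (by rw [hshift]; linarith) ⟨rfl, rfl⟩
    exact ⟨i, hi, j, hj, a, ha, by linarith, by linarith⟩
  obtain ⟨rfl, rfl⟩ := hzero
  by_contra hcon
  push Not at hcon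
  set L := s.filter fun i => d i ≤ 0 with hL
  set H := s.filter fun i => ¬ d i ≤ 0 with hH
  have hsplit : ∀ f : ι → ℝ, ∑ i ∈ s, f i = ∑ i ∈ L, f i + ∑ i ∈ H, f i :=
    fun f => (Finset.sum_filter_add_sum_filter_not s _ f).symm
  rw [hsplit] at hd hg
  have hLmem : ∀ i ∈ L, i ∈ s ∧ d i ≤ 0 := fun i hi => Finset.mem_filter.1 hi
  have hHmem : ∀ i ∈ H, i ∈ s ∧ 0 < d i := fun i hi =>
    ⟨(Finset.mem_filter.1 hi).1, not_le.1 (Finset.mem_filter.1 hi).2⟩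
  have hgL : ∀ i ∈ L, 0 < g i := by
    intro i hi
    have := hcon i (hLmem i hi).1 i (hLmem i hi).1 1 ⟨zero_le_one, le_rfl⟩
      (by linarith [(hLmem i hi).2])
    linarith
  -- The combination of `i` and `j` whose first coordinate vanishes.
  have hcross : ∀ i ∈ L, ∀ j ∈ H, 0 < d j * g i + -d i * g j := by
    intro i hi j hj
    have hi' := hLmem i hi
    have hj' := hHmem j hj
    have hpos : 0 < d j - d i := by linarith
    have h1 : 1 - d j / (d j - d i) = -d i / (d j - d i) := by field_simp; ring
    have := hcon i hi'.1 j hj'.1 (d j / (d j - d i))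
      ⟨by have := hj'.2; positivity, by rw [div_le_one hpos]; linarith⟩
      (by rw [h1]; apply le_of_eq; field_simp; ring)
    rw [h1] at this
    have h2 := mul_pos hpos this
    have h3 : (d j - d i) * (d j / (d j - d i) * g i + -d i / (d j - d i) * g j) =
        d j * g i + -d i * g j := by field_simp
    rwa [h3] at h2
  have hLne : L.Nonempty := by
    by_contra h
    rw [Finset.not_nonempty_iff_eq_empty] at h
    have hne : H.Nonempty := by
      by_contra h'
      rw [Finset.not_nonempty_iff_eq_empty] at h'
      rw [hsplit, h, h', Finset.sum_empty, add_zero] at hw1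
      exact zero_ne_one hw1
    have := Finset.sum_pos (fun i hi => mul_pos (hw i (hHmem i hi).1) (hHmem i hi).2) hne
    rw [h, Finset.sum_empty] at hd
    linarith
  have hSL : 0 < ∑ i ∈ L, w i * g i :=
    Finset.sum_pos (fun i hi => mul_pos (hw i (hLmem i hi).1) (hgL i hi)) hLne
  have hHne : H.Nonempty := by
    by_contra h
    rw [Finset.not_nonempty_iff_eq_empty] at h
    rw [h, Finset.sum_empty] at hg
    linarith
  have htot : 0 < (∑ j ∈ H, w j * d j) * (∑ i ∈ L, w i * g i) +
      (∑ i ∈ L, w i * -d i) * (∑ j ∈ H, w j * g j) := by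
    rw [mul_comm (∑ j ∈ H, w j * d j), Finset.sum_mul_sum, Finset.sum_mul_sum,
      ← Finset.sum_add_distrib]
    refine Finset.sum_pos (fun i hi => ?_) hLne
    rw [← Finset.sum_add_distrib]
    refine Finset.sum_pos (fun j hj => ?_) hHne
    have := mul_pos (mul_pos (hw i (hLmem i hi).1) (hw j (hHmem j hj).1)) (hcross i hi j hj)
    linarith
  simp only [mul_neg, Finset.sum_neg_distrib] at htot
  have hDH : 0 < ∑ j ∈ H, w j * d j :=
    Finset.sum_pos (fun j hj => mul_pos (hw j (hHmem j hj).1) (hHmem j hj).2) hHne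
  nlinarith

/-- The value `∑ₜ (1 - min{1, vₜ + a}^K)` of the objective at a deterministic error level `a`. -/
noncomputable def pointObjective (K : ℕ) (v : ℕ → ℝ) (a : ℝ) : ℝ≥0∞ :=
  ∑' t : ℕ, ENNReal.ofReal (1 - min 1 (v t + a) ^ K)

/-- A mixture of error levels over any finite set can be replaced by one over two levels, without
increasing the objective; two levels are available since `K + 1 ≥ 2`. -/
theorem exists_objectiveValues_le {K : ℕ} [NeZero K] (v : ℕ → ℝ) (c : ℝ) {ι : Type*} [Fintype ι]
    (w e : ι → ℝ) (hw : ∀ i, 0 ≤ w i) (hw1 : ∑ i, w i = 1) (he : ∀ i, e i ∈ Set.Icc (0 : ℝ) 1)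
    (hc : ∑ i, w i * e i ≤ c) :
    ∃ r ∈ objectiveValues K v c, r ≤ ∑ i, ENNReal.ofReal (w i) * pointObjective K v (e i) := by
  classical
  obtain ⟨K, rfl⟩ := Nat.exists_eq_succ_of_ne_zero (NeZero.ne K)
  set F := pointObjective (K + 1) v with hF
  -- Two error levels `b₀`, `b₁` with weights `a`, `1 - a`.
  have hpair : ∀ a ∈ Set.Icc (0 : ℝ) 1, ∀ b₀ ∈ Set.Icc (0 : ℝ) 1, ∀ b₁ ∈ Set.Icc (0 : ℝ) 1,
      a * b₀ + (1 - a) * b₁ ≤ c → ENNReal.ofReal a * F b₀ + ENNReal.ofReal (1 - a) * F b₁ ∈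
        objectiveValues (K + 1) v c := by
    intro a ha b₀ hb₀ b₁ hb₁ hab
    refine ⟨Fin.cons a (Fin.cons (1 - a) fun _ => 0), ⟨fun u => ?_, ?_⟩,
      Fin.cons b₀ fun _ => b₁, fun u => ?_, ?_, ?_⟩
    · refine Fin.cases ?_ (fun u => Fin.cases ?_ (fun u => ?_) u) u
      · simpa using ha.1
      · simpa using ha.2
      · simp
    · simp [Fin.sum_univ_succ]
    · refine Fin.cases ?_ (fun u => ?_) u
      · simpa using hb₀
      · simpa using hb₁
    · simpa [Fin.sum_univ_succ] using hab
    · simp [Fin.sum_univ_succ, hF, pointObjective]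
  rcases eq_or_ne (∑ i, ENNReal.ofReal (w i) * F (e i)) ∞ with htop | htop
  · have hc0 : 0 ≤ c := (Finset.sum_nonneg fun i _ => mul_nonneg (hw i) (he i).1).trans hc
    exact ⟨_, hpair 1 (by simp) 0 (by simp) 0 (by simp) (by simpa using hc0), by
      rw [htop]; exact le_top⟩
  set s := Finset.univ.filter fun i => 0 < w i with hs
  have hpos : ∀ i ∈ s, 0 < w i := fun i hi => (Finset.mem_filter.1 hi).2
  have hsum : ∀ f : ι → ℝ, ∑ i ∈ s, w i * f i = ∑ i, w i * f i := by
    intro f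
    refine Finset.sum_subset (Finset.subset_univ _) fun i _ hi => ?_
    have : w i = 0 := le_antisymm (not_lt.1 fun h => hi (by simp [hs, h])) (hw i)
    simp [this]
  have hfin : ∀ i ∈ s, F (e i) ≠ ∞ := by
    intro i hi h
    apply htop
    rw [ENNReal.sum_eq_top]
    exact ⟨i, Finset.mem_univ i, by
      rw [h, ENNReal.mul_top (by simpa using hpos i hi)]⟩
  have hV : (∑ i, ENNReal.ofReal (w i) * F (e i)).toReal = ∑ i, w i * (F (e i)).toReal := by
    rw [ENNReal.toReal_sum (ENNReal.sum_ne_top.1 htop)]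
    simp only [ENNReal.toReal_mul, ENNReal.toReal_ofReal (hw _)]
  obtain ⟨i, hi, j, hj, a, ha, h1, h2⟩ := exists_pair_le s w e (fun i => (F (e i)).toReal) c _ hpos
    (by simpa [hw1] using hsum fun _ => 1) ((hsum e).trans_le hc) ((hsum _).trans hV.symm).le
  refine ⟨_, hpair a ha (e i) (he i) (e j) (he j) h1, ?_⟩
  rw [← ENNReal.ofReal_toReal (hfin i hi), ← ENNReal.ofReal_toReal (hfin j hj),
    ← ENNReal.ofReal_mul ha.1, ← ENNReal.ofReal_mul (sub_nonneg.2 ha.2),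
    ← ENNReal.ofReal_add (mul_nonneg ha.1 ENNReal.toReal_nonneg)
      (mul_nonneg (sub_nonneg.2 ha.2) ENNReal.toReal_nonneg)]
  exact (ENNReal.ofReal_le_ofReal h2).trans_eq (ENNReal.ofReal_toReal htop)

/-- The minimum is attained: the feasible points form a compact set, and the objective is lower
semicontinuous as a sum of nonnegative continuous functions. -/
theorem exists_isLeast_objectiveValues (K : ℕ) (v : ℕ → ℝ) {c : ℝ} (hc : 0 ≤ c) :
    ∃ m, IsLeast (objectiveValues K v c) m := by
  set A : Set ((Fin (K + 1) → ℝ) × (Fin (K + 1) → ℝ)) :=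
    (stdSimplex ℝ (Fin (K + 1)) ×ˢ Set.pi Set.univ fun _ => Set.Icc (0 : ℝ) 1) ∩
      {q | ∑ u, q.1 u * q.2 u ≤ c} with hA
  have hcomp : IsCompact A :=
    ((isCompact_stdSimplex ℝ _).prod (isCompact_univ_pi fun _ => isCompact_Icc)).inter_right
      (isClosed_le (by fun_prop) continuous_const)
  have hne : A.Nonempty := by
    refine ⟨(Pi.single 0 1, 0), ⟨single_mem_stdSimplex ℝ 0, ?_⟩, ?_⟩
    · exact fun u _ => ⟨le_rfl, zero_le_one⟩
    · simpa using hc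
  set obj : (Fin (K + 1) → ℝ) × (Fin (K + 1) → ℝ) → ℝ≥0∞ := fun q =>
    ∑ u, ENNReal.ofReal (q.1 u) * ∑' t : ℕ, ENNReal.ofReal (1 - min 1 (v t + q.2 u) ^ K) with hobj
  have hlsc : LowerSemicontinuous obj := by
    have : obj = fun q => ∑ u, ∑' t : ℕ,
        ENNReal.ofReal (q.1 u) * ENNReal.ofReal (1 - min 1 (v t + q.2 u) ^ K) := by
      funext q
      simp only [hobj, ENNReal.tsum_mul_left]
    rw [this]
    refine lowerSemicontinuous_sum fun u _ => lowerSemicontinuous_tsum fun t => ?_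
    simp only [ENNReal.ofReal, ← ENNReal.coe_mul]
    exact Continuous.lowerSemicontinuous (by fun_prop)
  obtain ⟨q, hq, hmin⟩ := (hlsc.lowerSemicontinuousOn A).exists_isMinOn hne hcomp
  refine ⟨obj q, ⟨q.1, hq.1.1, q.2, fun u => hq.1.2 u (Set.mem_univ u), hq.2, rfl⟩, ?_⟩
  rintro r ⟨p, hp, e, he, hpe, rfl⟩
  exact hmin (show (p, e) ∈ A from ⟨⟨hp, fun u _ => he u⟩, hpe⟩)

end Optimization

/-! ### Independence of the decoders given the message -/

/-- Given the input word, the decoders act independently; by the inequality of the means, the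
probability that all of them have stopped is largest when their error levels agree. -/
theorem prod_le_min_average_pow {K : ℕ} [NeZero K] (q e : Fin K → ℝ) (v : ℝ)
    (hq0 : ∀ k, 0 ≤ q k) (hq1 : ∀ k, q k ≤ 1) (hqe : ∀ k, q k ≤ v + e k) :
    ∏ k, q k ≤ min 1 (v + (K : ℝ)⁻¹ * ∑ k, e k) ^ K := by
  have hK : (K : ℝ) ≠ 0 := Nat.cast_ne_zero.2 (NeZero.ne K)
  have hgm := Real.geom_mean_le_arith_mean_weighted Finset.univ (fun _ : Fin K => (K : ℝ)⁻¹) q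
    (fun _ _ => by positivity) (by simp [hK]) (fun k _ => hq0 k)
  have hpow : (∏ k, q k ^ (K : ℝ)⁻¹) ^ K = ∏ k, q k := by
    rw [← Finset.prod_pow]
    exact Finset.prod_congr rfl fun k _ => Real.rpow_inv_natCast_pow (hq0 k) (NeZero.ne K)
  rw [← hpow]
  refine pow_le_pow_left₀ (Finset.prod_nonneg fun k _ => Real.rpow_nonneg (hq0 k) _)
    (hgm.trans ?_) K
  rw [← Finset.mul_sum]
  refine le_min ?_ ?_
  · rw [inv_mul_le_iff₀ (by positivity), mul_one]
    simpa using Finset.sum_le_sum fun k (_ : k ∈ Finset.univ) => hq1 k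
  · have h := Finset.sum_le_sum fun k (_ : k ∈ Finset.univ) => hqe k
    rw [Finset.sum_add_distrib, Finset.sum_const, Finset.card_univ, Fintype.card_fin,
      nsmul_eq_mul] at h
    rw [inv_mul_le_iff₀ (by positivity), mul_add, mul_inv_cancel_left₀ hK]
    exact h

namespace Code

variable {X Y : Type*} [Fintype Y] {K : ℕ} [NeZero K] {W : Fin K → Channel X Y} {ℓ : ℝ≥0}
  {M : ℕ} {ε : ℝ} {Ω 𝒰 : Type*} [MeasurableSpace Ω] {μ : Measure Ω} [Fintype 𝒰]
  (code : Code W ℓ M ε (𝒰 := 𝒰) μ)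

/-- The first `n` outputs of channel `k`. -/
def word (k : Fin K) (n : ℕ) (ω : Ω) : Fin n → Y := fun i => code.out k i ω

/-- The event that the common randomness is `u` and the message is `j`. -/
def cell (u : 𝒰) (j : Fin M) : Set Ω := {ω | code.U ω = u ∧ code.J ω = j}

/-- The probability of `cell u j`, in the form in which it enters `Code.law`. -/
noncomputable def weight (u : 𝒰) : ℝ :=
  μ.real {ω | code.U ω = u} * (M : ℝ)⁻¹

theorem weight_nonneg (u : 𝒰) : 0 ≤ code.weight u := by
  unfold weight; positivity

theorem measurableSet_U (u : 𝒰) : MeasurableSet {ω | code.U ω = u} :=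
  code.measurable_U (t := {u}) trivial

theorem measurableSet_J (j : Fin M) : MeasurableSet {ω | code.J ω = j} :=
  code.measurable_J (t := {j}) trivial

theorem measurableSet_cell (u : 𝒰) (j : Fin M) : MeasurableSet (code.cell u j) :=
  (code.measurableSet_U u).inter (code.measurableSet_J j)

theorem measurableSet_word (k : Fin K) (n : ℕ) (S : Set (Fin n → Y)) :
    MeasurableSet {ω | code.word k n ω ∈ S} := by
  let _ : MeasurableSpace Y := ⊤
  have h : Measurable (code.word k n) := measurable_pi_lambda _ fun i => code.measurable_out k i
  exact h (Set.toFinite S).measurableSet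

/-- Whether decoder `k` has stopped by time `n` is determined by the common randomness and the
first `n` outputs. -/
theorem tau_le_of_word_eq {k : Fin K} {n : ℕ} {ω ω' : Ω} (hU : code.U ω = code.U ω')
    (hword : code.word k n ω = code.word k n ω') (h : code.τ k ω ≤ n) : code.τ k ω' ≤ n := by
  obtain ⟨S, -, hS⟩ := code.isStoppingTime k n
  have hiff : ∀ ω, code.τ k ω ≤ n ↔ (code.U ω, code.word k n ω) ∈ S := by
    intro ω
    have : ω ∈ (fun ω => (code.U ω, fun i : Fin n => code.out k i ω)) ⁻¹' S ↔
        ω ∈ {ω | (code.τ k ω : WithTop ℕ) ≤ n} := by rw [hS]; rfl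
    exact (this.trans (by simp)).symm
  rw [hiff] at h ⊢
  rwa [← hU, ← hword]

theorem tau_eq_of_word_eq {k : Fin K} {n : ℕ} {ω ω' : Ω} (hU : code.U ω = code.U ω')
    (hword : code.word k n ω = code.word k n ω') (h : code.τ k ω = n) : code.τ k ω' = n := by
  refine le_antisymm (code.tau_le_of_word_eq hU hword h.le) (le_of_not_gt fun hlt => ?_)
  have hword' : code.word k (code.τ k ω') ω' = code.word k (code.τ k ω') ω := by
    funext i
    exact (congrFun hword ⟨i, i.2.trans hlt⟩).symm
  exact absurd (code.tau_le_of_word_eq hU.symm hword' le_rfl) (by omega)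

/-- The words of length `n` on which decoder `k` has stopped by time `n`, if `U = u`. -/
def stoppedBy (k : Fin K) (n : ℕ) (u : 𝒰) : Set (Fin n → Y) :=
  {y | ∃ ω, code.U ω = u ∧ code.word k n ω = y ∧ code.τ k ω ≤ n}

/-- The words of length `n` on which decoder `k` stops exactly at time `n`, if `U = u`. Only words
that occur are included, which makes the family prefix-free. -/
def stoppedAt (k : Fin K) (n : ℕ) (u : 𝒰) : Set (Fin n → Y) :=
  {y | ∃ ω, code.U ω = u ∧ code.word k n ω = y ∧ code.τ k ω = n}

theorem word_mem_stoppedBy_iff {k : Fin K} {n : ℕ} {ω : Ω} :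
    code.word k n ω ∈ code.stoppedBy k n (code.U ω) ↔ code.τ k ω ≤ n :=
  ⟨fun ⟨_, hU, hw, h⟩ => code.tau_le_of_word_eq hU hw h, fun h => ⟨ω, rfl, rfl, h⟩⟩

theorem stoppedAt_prefix_free (k : Fin K) (u : 𝒰) (n m : ℕ) (h : n < m) (y : Fin m → Y)
    (hy : y ∈ code.stoppedAt k m u) :
    (fun i => y (Fin.castLE h.le i)) ∉ code.stoppedAt k n u := by
  rintro ⟨ω', hU', hw', hτ'⟩
  obtain ⟨ω, hU, rfl, hτ⟩ := hy
  have := code.tau_eq_of_word_eq (hU'.trans hU.symm) (hw'.trans rfl) hτ'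
  omega

theorem measurable_tau (k : Fin K) : Measurable (code.τ k) := by
  refine measurable_of_Iic fun n => ?_
  have h := (obsFiltration code.U (code.out k) code.measurable_U (code.measurable_out k)).le n _
    (code.isStoppingTime k n)
  simpa [Set.preimage, Set.Iic] using h

theorem cell_pairwise_disjoint :
    Pairwise (Function.onFun Disjoint fun p : 𝒰 × Fin M => code.cell p.1 p.2) := by
  intro p p' hne
  refine Set.disjoint_left.2 fun ω h h' => hne ?_
  exact Prod.ext (h.1.symm.trans h'.1) (h.2.symm.trans h'.2)

variable [IsProbabilityMeasure μ]

/-- Given `U` and `J`, the output words of the `K` channels are independent. -/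
theorem measureReal_cell_inter_forall (u : 𝒰) (j : Fin M) (n : ℕ)
    (S : Fin K → Set (Fin n → Y)) :
    μ.real (code.cell u j ∩ {ω | ∀ k, code.word k n ω ∈ S k}) =
      code.weight u * ∏ k, blockProb (W k) (fun i => code.f i u j) n (S k) := by
  classical
  have hset : code.cell u j ∩ {ω | ∀ k, code.word k n ω ∈ S k} =
      ⋃ y ∈ Finset.univ.filter fun y : Fin K → Fin n → Y => ∀ k, y k ∈ S k,
        {ω | code.U ω = u ∧ code.J ω = j ∧ ∀ k, ∀ i : Fin n, code.out k i ω = y k i} := by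
    ext ω
    simp only [cell, Set.mem_inter_iff, Set.mem_iUnion, Finset.mem_filter, Finset.mem_univ,
      true_and, exists_prop]
    constructor
    · rintro ⟨⟨h1, h2⟩, h3⟩
      exact ⟨fun k => code.word k n ω, h3, h1, h2, fun _ _ => rfl⟩
    · rintro ⟨y, hy, h1, h2, h3⟩
      refine ⟨⟨h1, h2⟩, fun k => ?_⟩
      have : code.word k n ω = y k := funext fun i => h3 k i
      rw [this]
      exact hy k
  have hmeas : ∀ y : Fin K → Fin n → Y, MeasurableSet
      {ω | code.U ω = u ∧ code.J ω = j ∧ ∀ k, ∀ i : Fin n, code.out k i ω = y k i} := by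
    intro y
    refine (code.measurableSet_U u).inter ((code.measurableSet_J j).inter ?_)
    have : {ω | ∀ k, ∀ i : Fin n, code.out k i ω = y k i} =
        ⋂ k, {ω | code.word k n ω ∈ ({y k} : Set (Fin n → Y))} := by
      ext ω
      simp [word, funext_iff]
    have h := MeasurableSet.iInter fun k => code.measurableSet_word k n {y k}
    rwa [← this] at h
  rw [hset, measureReal_biUnion_finset ?_ fun y _ => hmeas y]
  · simp only [code.law, blockProb]
    rw [Finset.sum_filter, Finset.prod_univ_sum, Finset.mul_sum, Fintype.piFinset_univ]
    refine Finset.sum_congr rfl fun y _ => ?_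
    rw [Finset.prod_ite_zero]
    simp only [Finset.mem_univ, true_implies, weight, mul_ite, mul_zero]
  · intro y _ y' _ hne
    refine Set.disjoint_left.2 fun ω h h' => hne ?_
    funext k i
    exact (h.2.2 k i).symm.trans (h'.2.2 k i)

theorem measureReal_cell_inter (u : 𝒰) (j : Fin M) (k : Fin K) (n : ℕ) (S : Set (Fin n → Y)) :
    μ.real (code.cell u j ∩ {ω | code.word k n ω ∈ S}) =
      code.weight u * blockProb (W k) (fun i => code.f i u j) n S := by
  classical
  have h := code.measureReal_cell_inter_forall u j n (Function.update (fun _ => Set.univ) k S)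
  have hset : {ω | ∀ l, code.word l n ω ∈
      Function.update (fun _ => (Set.univ : Set (Fin n → Y))) k S l} =
      {ω | code.word k n ω ∈ S} := by
    ext ω
    refine ⟨fun h => by simpa using h k, fun h l => ?_⟩
    by_cases hl : l = k
    · subst hl; simpa using h
    · simp [hl]
  rw [hset] at h
  rw [h, Finset.prod_eq_single k]
  · simp
  · intro l _ hl
    simp [hl, blockProb_univ]
  · simp

theorem measureReal_cell (u : 𝒰) (j : Fin M) : μ.real (code.cell u j) = code.weight u := by
  simpa [blockProb_univ] using code.measureReal_cell_inter u j 0 0 Set.univ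

theorem measureReal_eq_sum_cell (A : Set Ω) :
    μ.real A = ∑ p : 𝒰 × Fin M, μ.real (code.cell p.1 p.2 ∩ A) := by
  classical
  have h : μ A = ∑ p : 𝒰 × Fin M, μ (code.cell p.1 p.2 ∩ A) := by
    have hun : (⋃ p : 𝒰 × Fin M, code.cell p.1 p.2) = Set.univ := by
      ext ω
      simp [cell]
    have := measure_iUnion (μ := μ.restrict A) code.cell_pairwise_disjoint
      fun p => code.measurableSet_cell p.1 p.2
    rw [hun, Measure.restrict_apply_univ, tsum_fintype] at this
    rw [this]
    exact Finset.sum_congr rfl fun p _ => Measure.restrict_apply (code.measurableSet_cell p.1 p.2)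
  simp only [Measure.real]
  rw [h, ENNReal.toReal_sum fun p _ => measure_ne_top μ _]

theorem sum_weight : ∑ p : 𝒰 × Fin M, code.weight p.1 = 1 := by
  have h := code.measureReal_eq_sum_cell Set.univ
  simpa [measureReal_cell] using h.symm

theorem measureReal_cell_inter_tau_le (u : 𝒰) (j : Fin M) (k : Fin K) (t : ℕ) :
    μ.real (code.cell u j ∩ {ω | code.τ k ω ≤ t}) =
      code.weight u * blockProb (W k) (fun i => code.f i u j) t (code.stoppedBy k t u) := by
  rw [← measureReal_cell_inter]
  congr 1
  ext ω
  simp only [Set.mem_inter_iff]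
  refine and_congr_right fun h => ?_
  have := code.word_mem_stoppedBy_iff (k := k) (n := t) (ω := ω)
  rw [h.1] at this
  exact this.symm

theorem measureReal_forall_tau_le (t : ℕ) :
    μ.real {ω | ∀ k, code.τ k ω ≤ t} = ∑ p : 𝒰 × Fin M, code.weight p.1 *
      ∏ k, blockProb (W k) (fun i => code.f i p.1 p.2) t (code.stoppedBy k t p.1) := by
  rw [code.measureReal_eq_sum_cell]
  refine Finset.sum_congr rfl fun p _ => ?_
  rw [← measureReal_cell_inter_forall]
  congr 1
  ext ω
  simp only [Set.mem_inter_iff]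
  refine and_congr_right fun h => forall_congr' fun k => ?_
  have := code.word_mem_stoppedBy_iff (k := k) (n := t) (ω := ω)
  rw [h.1] at this
  exact this.symm

/-- The expected maximum of the stopping times, as a sum of tail probabilities. -/
theorem lintegral_max_tau :
    ∫⁻ ω, ((Finset.univ.sup' Finset.univ_nonempty fun k => code.τ k ω : ℕ) : ℝ≥0∞) ∂μ =
      ∑' t : ℕ, ENNReal.ofReal (1 - μ.real {ω | ∀ k, code.τ k ω ≤ t}) := by
  classical
  have hmeas : ∀ t : ℕ, MeasurableSet {ω | ∀ k, code.τ k ω ≤ t} := by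
    intro t
    have : {ω | ∀ k, code.τ k ω ≤ t} = ⋂ k, code.τ k ⁻¹' Set.Iic t := by
      ext ω; simp
    rw [this]
    exact MeasurableSet.iInter fun k => code.measurable_tau k measurableSet_Iic
  have hcount : ∀ ω, ((Finset.univ.sup' Finset.univ_nonempty fun k => code.τ k ω : ℕ) : ℝ≥0∞) =
      ∑' t : ℕ, {ω | ∀ k, code.τ k ω ≤ t}ᶜ.indicator (fun _ => (1 : ℝ≥0∞)) ω := by
    intro ω
    set m := Finset.univ.sup' Finset.univ_nonempty fun k => code.τ k ω with hm
    have hmem : ∀ t, ω ∈ {ω | ∀ k, code.τ k ω ≤ t}ᶜ ↔ t ∈ Finset.range m := by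
      intro t
      rw [Finset.mem_range, hm, ← not_le, Finset.sup'_le_iff]
      simp
    rw [tsum_eq_sum (s := Finset.range m)
      fun t ht => Set.indicator_of_notMem (fun h => ht ((hmem t).1 h)) _]
    rw [Finset.sum_congr rfl fun t ht => Set.indicator_of_mem ((hmem t).2 ht) _]
    simp
  simp only [hcount]
  rw [lintegral_tsum fun t => (measurable_const.indicator (hmeas t).compl).aemeasurable]
  refine tsum_congr fun t => ?_
  rw [lintegral_indicator_const (hmeas t).compl, one_mul, ← probReal_compl_eq_one_sub (hmeas t),
    ofReal_measureReal]

end Code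

/-! ### Change of measure and the converse -/

/-- The channel whose output is uniform, whatever the input. -/
noncomputable def uniformChannel (X Y : Type*) [Fintype Y] [Nonempty Y] : Channel X Y where
  prob _ _ := (Fintype.card Y : ℝ)⁻¹
  nonneg _ _ := by positivity
  sum_one _ := by simp

/-- Change of measure: a word of small information density is at most `C` times as likely as under
the uniform output distribution. For words of probability zero this holds whatever the value of
the information density. -/
theorem prod_le_of_infoDensity_lt {X Y : Type*} [Fintype X] [Fintype Y] [Nonempty Y] {P : X → ℝ}
    {W : Channel X Y} (hq : ∀ y, outputDist P W y = (Fintype.card Y : ℝ)⁻¹) {C : ℝ} (hC : 0 < C)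
    {n : ℕ} (x : Fin n → X) (y : Fin n → Y) (h : infoDensity P W x y < Real.log C) :
    ∏ i, W.prob (x i) (y i) ≤ C * ∏ i, (uniformChannel X Y).prob (x i) (y i) := by
  have hcard : (0 : ℝ) < (Fintype.card Y : ℝ)⁻¹ := by positivity
  have hQ : 0 < ∏ i, (uniformChannel X Y).prob (x i) (y i) :=
    Finset.prod_pos fun i _ => hcard
  by_cases h0 : ∃ i, W.prob (x i) (y i) = 0
  · obtain ⟨i, hi⟩ := h0
    rw [Finset.prod_eq_zero (Finset.mem_univ i) hi]
    positivity
  · push Not at h0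
    have hpos : ∀ i, 0 < W.prob (x i) (y i) := fun i => lt_of_le_of_ne (W.nonneg _ _) (h0 i).symm
    have hlog : infoDensity P W x y =
        Real.log ((∏ i, W.prob (x i) (y i)) / ∏ i, (uniformChannel X Y).prob (x i) (y i)) := by
      rw [infoDensity, ← Finset.prod_div_distrib, Real.log_prod]
      · simp only [hq, uniformChannel]
      · exact fun i _ => (div_pos (hpos i) hcard).ne'
    rw [hlog, Real.log_lt_log_iff (div_pos (Finset.prod_pos fun i _ => hpos i) hQ) hC,
      div_lt_iff₀ hQ] at h
    exact h.le

namespace Code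

variable {X Y : Type*} [Fintype X] [Fintype Y] {K : ℕ} [NeZero K] {W : Fin K → Channel X Y}
  {ℓ : ℝ≥0} {M : ℕ} {ε : ℝ} {Ω 𝒰 : Type*} [MeasurableSpace Ω] {μ : Measure Ω}
  [Fintype 𝒰] (code : Code W ℓ M ε (𝒰 := 𝒰) μ)

/-- The event that decoder `k` stops while the information density is still below `lam`. -/
def stopsEarly (P : X → ℝ) (lam : ℝ) (k : Fin K) : Set Ω :=
  {ω | infoDensity P (W k) (fun i : Fin (code.τ k ω) => code.f i (code.U ω) (code.J ω))
    (code.word k (code.τ k ω) ω) < lam}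

/-- The event that the estimate of decoder `k` is correct. -/
def isCorrect (k : Fin K) : Set Ω :=
  {ω | code.J ω = code.g k (code.τ k ω) (code.U ω) (code.word k (code.τ k ω) ω)}

variable [IsProbabilityMeasure μ]

/-- A decoder that has stopped by time `t` has either seen the information density cross `lam` or
stopped early. -/
theorem measureReal_cell_inter_tau_le_add (P : X → ℝ) (lam : ℝ) (u : 𝒰) (j : Fin M) (k : Fin K)
    (t : ℕ) :
    μ.real (code.cell u j ∩ {ω | code.τ k ω ≤ t}) ≤
      code.weight u * crossingProb P (W k) (fun i => code.f i u j) lam t +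
        μ.real (code.cell u j ∩ code.stopsEarly P lam k) := by
  rw [crossingProb_eq_blockProb, ← measureReal_cell_inter]
  refine (measureReal_mono ?_).trans (measureReal_union_le _ _)
  rintro ω ⟨hcell, hτ⟩
  by_cases hω : ω ∈ code.stopsEarly P lam k
  · exact Or.inr ⟨hcell, hω⟩
  · refine Or.inl ⟨hcell, ?_⟩
    have hlam : lam ≤ infoDensity P (W k)
        (fun i : Fin (code.τ k ω) => code.f i (code.U ω) (code.J ω))
        (code.word k (code.τ k ω) ω) := not_lt.1 hω
    rw [hcell.1, hcell.2] at hlam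
    exact hlam.trans (Finset.le_sup' (fun n : Fin (t + 1) => infoDensity P (W k)
      (fun i : Fin n => code.f (Fin.castLE (Nat.le_of_lt_succ n.2) i) u j)
      fun i : Fin n => code.word k t ω (Fin.castLE (Nat.le_of_lt_succ n.2) i))
      (Finset.mem_univ (⟨code.τ k ω, Nat.lt_succ_of_le hτ⟩ : Fin (t + 1))))

theorem measureReal_stopsEarly_inter_isCorrect_inter_tau_eq_le [Nonempty Y] {P : X → ℝ}
    (k : Fin K) (hq : ∀ y, outputDist P (W k) y = (Fintype.card Y : ℝ)⁻¹) {C : ℝ} (hC : 0 < C)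
    (n : ℕ) :
    μ.real (code.stopsEarly P (Real.log C) k ∩ code.isCorrect k ∩ {ω | code.τ k ω = n}) ≤
      ∑ u, code.weight u * (C * blockProb (uniformChannel Unit Y) (fun _ => ()) n
        (code.stoppedAt k n u)) := by
  classical
  rw [code.measureReal_eq_sum_cell, Fintype.sum_prod_type]
  refine Finset.sum_le_sum fun u _ => ?_
  set R : Fin M → Set (Fin n → Y) := fun j => {y | y ∈ code.stoppedAt k n u ∧
    infoDensity P (W k) (fun i : Fin n => code.f i u j) y < Real.log C ∧ j = code.g k n u y}
    with hR
  have hcell : ∀ j, μ.real (code.cell u j ∩ (code.stopsEarly P (Real.log C) k ∩ code.isCorrect k ∩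
      {ω | code.τ k ω = n})) ≤
      code.weight u * blockProb (W k) (fun i => code.f i u j) n (R j) := by
    intro j
    rw [← measureReal_cell_inter]
    refine measureReal_mono ?_
    rintro ω ⟨⟨rfl, rfl⟩, ⟨hearly, hcorrect⟩, rfl⟩
    exact ⟨⟨rfl, rfl⟩, ⟨ω, rfl, rfl, rfl⟩, hearly, hcorrect⟩
  refine (Finset.sum_le_sum fun j _ => hcell j).trans ?_
  rw [← Finset.mul_sum]
  refine mul_le_mul_of_nonneg_left ?_ (code.weight_nonneg u)
  simp only [blockProb]
  rw [Finset.sum_comm, Finset.mul_sum]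
  refine Finset.sum_le_sum fun y _ => ?_
  have hQ : 0 ≤ ∏ i : Fin n, (uniformChannel Unit Y).prob () (y i) :=
    Finset.prod_nonneg fun i _ => (uniformChannel Unit Y).nonneg _ _
  -- Only the message decoded from `y` contributes.
  rw [Finset.sum_eq_single (code.g k n u y) (fun j _ hj => if_neg fun h => hj h.2.2) (by simp)]
  by_cases hy : y ∈ R (code.g k n u y)
  · rw [if_pos hy, if_pos hy.1]
    exact prod_le_of_infoDensity_lt hq hC _ y hy.2.1
  · rw [if_neg hy]
    split_ifs
    · positivity
    · simp

/-- A decoder rarely stops early with the correct estimate. Were the outputs uniform and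
independent of the message, the estimate would be correct with probability `1 / M`; the change of
measure costs a factor below `M * η`. -/
theorem measureReal_stopsEarly_inter_isCorrect_le [Nonempty Y] {P : X → ℝ} (k : Fin K)
    (hq : ∀ y, outputDist P (W k) y = (Fintype.card Y : ℝ)⁻¹) {η : ℝ} (hη : 0 < η) (hM : 1 ≤ M) :
    μ.real (code.stopsEarly P (Real.log (M * η)) k ∩ code.isCorrect k) ≤ η := by
  have hMpos : (0 : ℝ) < M := by exact_mod_cast hM
  set B := code.stopsEarly P (Real.log (M * η)) k ∩ code.isCorrect k with hB
  set T := fun n u => blockProb (uniformChannel Unit Y) (fun _ => ()) n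
    (code.stoppedAt k n u) with hT
  have hpartial : ∀ N, ∑ n ∈ Finset.range N, μ.real (B ∩ {ω | code.τ k ω = n}) ≤ η := by
    intro N
    have hU : ∑ u, code.weight u * M = 1 := by
      have h := code.sum_weight
      rw [Fintype.sum_prod_type] at h
      simpa [mul_comm] using h
    calc ∑ n ∈ Finset.range N, μ.real (B ∩ {ω | code.τ k ω = n})
        ≤ ∑ n ∈ Finset.range N, ∑ u, code.weight u * (M * η * T n u) :=
          Finset.sum_le_sum fun n _ =>
            code.measureReal_stopsEarly_inter_isCorrect_inter_tau_eq_le k hq (mul_pos hMpos hη) n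
      _ = ∑ u, code.weight u * M * η * ∑ n ∈ Finset.range N, T n u := by
          rw [Finset.sum_comm]
          refine Finset.sum_congr rfl fun u _ => ?_
          rw [Finset.mul_sum]
          exact Finset.sum_congr rfl fun n _ => by ring
      _ ≤ ∑ u, code.weight u * M * η * 1 := by
          refine Finset.sum_le_sum fun u _ => mul_le_mul_of_nonneg_left
            (sum_blockProb_le_one _ _ _ (code.stoppedAt_prefix_free k u) N) ?_
          have := code.weight_nonneg u
          positivity
      _ = η := by
          simp only [mul_one]
          rw [← Finset.sum_mul, hU, one_mul]
  have hcover : B ⊆ ⋃ n, B ∩ {ω | code.τ k ω = n} :=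
    fun ω hω => Set.mem_iUnion.2 ⟨code.τ k ω, hω, rfl⟩
  have hle : μ B ≤ ENNReal.ofReal η := by
    refine ((measure_mono hcover).trans (measure_iUnion_le _)).trans
      (ENNReal.tsum_le_of_sum_range_le fun N => ?_)
    rw [← ENNReal.ofReal_toReal (a := ∑ n ∈ Finset.range N, μ (B ∩ {ω | code.τ k ω = n}))
      (ENNReal.sum_ne_top.2 fun _ _ => measure_ne_top μ _),
      ENNReal.toReal_sum fun _ _ => measure_ne_top μ _]
    exact ENNReal.ofReal_le_ofReal (hpartial N)
  exact ENNReal.toReal_le_of_le_ofReal hη.le hle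

theorem measureReal_stopsEarly_le [Nonempty Y] {P : X → ℝ} (k : Fin K)
    (hq : ∀ y, outputDist P (W k) y = (Fintype.card Y : ℝ)⁻¹) {η : ℝ} (hη : 0 < η) (hM : 1 ≤ M) :
    μ.real (code.stopsEarly P (Real.log (M * η)) k) ≤ ε + η := by
  refine (measureReal_mono ?_).trans ((measureReal_union_le _ _).trans
    (add_le_add (code.error_le k)
      (code.measureReal_stopsEarly_inter_isCorrect_le k hq hη hM)))
  intro ω hω
  by_cases h : ω ∈ code.isCorrect k
  · exact Or.inr ⟨hω, h⟩
  · exact Or.inl h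

/-- The probability that decoder `k` stops early, given `U = u` and `J = j`; it is `0` when this
condition has probability zero. -/
noncomputable def condEarly (P : X → ℝ) (lam : ℝ) (k : Fin K) (u : 𝒰) (j : Fin M) : ℝ :=
  μ.real (code.cell u j ∩ code.stopsEarly P lam k) / code.weight u

theorem condEarly_mem_Icc (P : X → ℝ) (lam : ℝ) (k : Fin K) (u : 𝒰) (j : Fin M) :
    code.condEarly P lam k u j ∈ Set.Icc (0 : ℝ) 1 := by
  refine ⟨div_nonneg measureReal_nonneg (code.weight_nonneg u),
    div_le_one_of_le₀ ?_ (code.weight_nonneg u)⟩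
  rw [← code.measureReal_cell u j]
  exact measureReal_mono Set.inter_subset_left

theorem weight_mul_condEarly (P : X → ℝ) (lam : ℝ) (k : Fin K) (u : 𝒰) (j : Fin M) :
    code.weight u * code.condEarly P lam k u j =
      μ.real (code.cell u j ∩ code.stopsEarly P lam k) := by
  refine mul_div_cancel_of_imp' fun h => le_antisymm ?_ measureReal_nonneg
  rw [← h, ← code.measureReal_cell u j]
  exact measureReal_mono Set.inter_subset_left

/-- The converse for a code: the expected maximum of the stopping times is at least the objective
at the average error levels of the decoders given `U` and `J`. -/
theorem sum_weight_mul_pointObjective_le (P : X → ℝ) (lam : ℝ) (v : ℕ → ℝ)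
    (hv : ∀ k u j t, crossingProb P (W k) (fun i => code.f i u j) lam t = v t) :
    ∑ p : 𝒰 × Fin M, ENNReal.ofReal (code.weight p.1) *
      pointObjective K v ((K : ℝ)⁻¹ * ∑ k, code.condEarly P lam k p.1 p.2) ≤ ℓ := by
  refine le_trans ?_ code.expected_le
  rw [code.lintegral_max_tau]
  simp only [pointObjective, ← ENNReal.tsum_mul_left, ← ENNReal.ofReal_mul (code.weight_nonneg _)]
  rw [← Summable.tsum_finsetSum fun _ _ => ENNReal.summable]
  refine ENNReal.tsum_le_tsum fun t => ?_
  have hpoint : ∀ p : 𝒰 × Fin M, code.weight p.1 *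
      ∏ k, blockProb (W k) (fun i => code.f i p.1 p.2) t (code.stoppedBy k t p.1) ≤
      code.weight p.1 *
        min 1 (v t + (K : ℝ)⁻¹ * ∑ k, code.condEarly P lam k p.1 p.2) ^ K := by
    intro p
    rcases (code.weight_nonneg p.1).eq_or_lt with h0 | hpos
    · simp [← h0]
    refine mul_le_mul_of_nonneg_left (prod_le_min_average_pow _ _ _
      (fun k => blockProb_nonneg _ _ _ _) (fun k => blockProb_le_one _ _ _ _) fun k => ?_) hpos.le
    have h := code.measureReal_cell_inter_tau_le_add P lam p.1 p.2 k t
    rw [measureReal_cell_inter_tau_le, ← weight_mul_condEarly, hv, ← mul_add] at h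
    exact le_of_mul_le_mul_left h hpos
  have hnonneg : ∀ p : 𝒰 × Fin M, 0 ≤ v t + (K : ℝ)⁻¹ * ∑ k, code.condEarly P lam k p.1 p.2 := by
    intro p
    rw [← hv 0 p.1 p.2 t, crossingProb_eq_blockProb]
    exact add_nonneg (blockProb_nonneg _ _ _ _) (mul_nonneg (by positivity)
      (Finset.sum_nonneg fun k _ => (code.condEarly_mem_Icc P lam k p.1 p.2).1))
  rw [← ENNReal.ofReal_sum_of_nonneg fun p _ => mul_nonneg (code.weight_nonneg _)
    (sub_nonneg.2 (pow_le_one₀ (le_min zero_le_one (hnonneg p)) (min_le_left _ _)))]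
  refine ENNReal.ofReal_le_ofReal ?_
  simp only [mul_sub, mul_one, Finset.sum_sub_distrib]
  rw [code.sum_weight, code.measureReal_forall_tau_le]
  exact sub_le_sub_left (Finset.sum_le_sum fun p _ => hpoint p) 1

end Code

end VLSF

theorem corollary1 {X Y : Type*} [Fintype X] [Fintype Y] {K : ℕ} [NeZero K]
    (W : Fin K → VLSF.Channel X Y) (hid : ∀ k, W k = W 0) (hsymm : (W 0).IsSymmetric)
    (Pstar : X → ℝ) (hP : VLSF.IsCapacityAchieving W Pstar)
    (M : ℕ) (hM : 1 ≤ M) (η : ℝ) (hη : 0 < η) (x : ℕ → X)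
    (v : ℕ → ℝ)
    (hv : ∀ t, v t = VLSF.crossingProb Pstar (W 0) x (Real.log M + Real.log η) t)
    (ℓ : ℝ≥0) (ε : ℝ)
    {Ω 𝒰 : Type*} [MeasurableSpace Ω] (μ : Measure Ω) [IsProbabilityMeasure μ] [Fintype 𝒰]
    (code : VLSF.Code W ℓ M ε (𝒰 := 𝒰) μ) :
    ∃ m : ℝ≥0∞, IsLeast (VLSF.objectiveValues K v (ε + η)) m ∧ m ≤ ℓ := by
  have hMpos : (0 : ℝ) < M := by exact_mod_cast hM
  rw [← Real.log_mul hMpos.ne' hη.ne'] at hv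
  have hY : Nonempty Y := by
    by_contra h
    rw [not_nonempty_iff] at h
    simpa using (W 0).sum_one (x 0)
  -- The output distribution is uniform, so that `v` does not depend on the input word.
  have hq : ∀ y, VLSF.outputDist Pstar (W 0) y = (Fintype.card Y : ℝ)⁻¹ :=
    VLSF.outputDist_eq_inv_card hsymm hP.1 fun P' hP' => by simpa [hid] using hP.2 P' hP'
  have hK : (0 : ℝ) < K := Nat.cast_pos.2 (NeZero.pos K)
  set lam := Real.log (M * η) with hlam
  -- The pair `(U, J)` takes the part of the random variable in the minimization.
  set e : 𝒰 × Fin M → ℝ := fun p => (K : ℝ)⁻¹ * ∑ k, code.condEarly Pstar lam k p.1 p.2 with he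
  have hconv := code.sum_weight_mul_pointObjective_le Pstar lam v fun k u j t => by
    rw [hid k, hv t]
    exact VLSF.crossingProb_congr hsymm hq _ _ _ _
  have he01 : ∀ p, e p ∈ Set.Icc (0 : ℝ) 1 := by
    intro p
    have hmem := fun k => code.condEarly_mem_Icc Pstar lam k p.1 p.2
    refine ⟨mul_nonneg (by positivity) (Finset.sum_nonneg fun k _ => (hmem k).1), ?_⟩
    rw [he, inv_mul_le_iff₀ hK, mul_one]
    simpa using Finset.sum_le_sum fun k (_ : k ∈ Finset.univ) => (hmem k).2
  have hmean : ∑ p : 𝒰 × Fin M, code.weight p.1 * e p ≤ ε + η := by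
    have hswap : ∑ p : 𝒰 × Fin M, code.weight p.1 * e p =
        (K : ℝ)⁻¹ * ∑ k, μ.real (code.stopsEarly Pstar lam k) := by
      simp only [code.measureReal_eq_sum_cell (code.stopsEarly _ _ _),
        ← code.weight_mul_condEarly]
      rw [Finset.sum_comm, Finset.mul_sum]
      refine Finset.sum_congr rfl fun p _ => ?_
      rw [← Finset.mul_sum]
      ring
    rw [hswap, inv_mul_le_iff₀ hK]
    have h := Finset.sum_le_sum fun k (_ : k ∈ Finset.univ) =>
      code.measureReal_stopsEarly_le k (fun y => by rw [hid k]; exact hq y) hη hM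
    rw [Finset.sum_const, Finset.card_univ, Fintype.card_fin, nsmul_eq_mul] at h
    exact h
  have hc : 0 ≤ ε + η :=
    (Finset.sum_nonneg fun p _ => mul_nonneg (code.weight_nonneg _) (he01 p).1).trans hmean
  obtain ⟨m, hm⟩ := VLSF.exists_isLeast_objectiveValues K v hc
  obtain ⟨r, hr, hle⟩ := VLSF.exists_objectiveValues_le (K := K) (ι := 𝒰 × Fin M) v (ε + η)
    (fun p => code.weight p.1) e
    (fun p => code.weight_nonneg p.1) code.sum_weight he01 hmean
  exact ⟨m, hm, (hm.2 hr).trans (hle.trans hconv)⟩
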